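/- For a (real) distribution $\mathsf{f}\in\mathcal{D}'(\mathbb{R})$, a point $x\in\mathbb{R}$, a number $\varepsilon\neq 0$ and a test function $\phi\in\mathcal{D}(\mathbb{R})$ put $$\langle \mathsf{f}(x+\varepsilon y),\phi(y)\rangle=\Big\langle \mathsf{f}(u),\tfrac{1}{|\varepsilon|}\,\phi\big(\tfrac{u-x}{\varepsilon}\big)\Big\rangle .$$ A distribution $\mathsf{F}\in\mathcal{D}'(\mathbb{R})$ is a *Łojasiewicz distribution* if for every $x_0\in\mathbb{R}$ its distributional point value exists, i.e. there is $\gamma\in\mathbb{R}$ with $\lim_{\varepsilon\to0}\langle \mathsf{F}(x_0+\varepsilon y),\phi(y)\rangle=\gamma\int_{-\infty}^{\infty}\phi(y)\,dy$ for all $\phi\in\mathcal{D}(\mathbb{R})$. The *$\phi$-transform* of $\mathsf{f}$ is $F(x,t)=\langle \mathsf{f}(x+ty),\phi(y)\rangle$ for $x\in\mathbb{R}$, $t>0$. For $x_0\in\mathbb{R}$ and an angle $0\le\theta<\pi/2$ let $C_{x_0,\theta}=\{(x,t): t>0,\ |x-x_0|\le(\tan\theta)\,t\}$ and let $$\mathsf{f}^{+}_{\phi,\theta}(x_0)=\limsup_{\substack{(x,t)\to(x_0,0)\\(x,t)\in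 C_{x_0,\theta}}}F(x,t),\qquad \mathsf{f}^{-}_{\phi,\theta}(x_0)=\liminf_{\substack{(x,t)\to(x_0,0)\\(x,t)\in C_{x_0,\theta}}}F(x,t)$$ in $[-\infty,\infty]$; for $\theta=0$ these are the upper and lower radial limits. **Theorem.** Let $\mathsf{f}\in\mathcal{D}'(\mathbb{R})$ be such that $\mathsf{f}=\mathsf{F}'$ for a Łojasiewicz distribution $\mathsf{F}$. Let $U\subseteq\mathbb{R}$ be open. Let $\phi\in\mathcal{D}(\mathbb{R})$ be a test function with $\phi\ge0$, $\int_{-\infty}^{\infty}\phi(x)\,dx=1$ and $\operatorname{supp}\phi\subseteq[-R,R]$, and let $\arctan R<\theta<\pi/2$. Suppose that $$\mathsf{f}^{+}_{\phi,0}(x)\ge0\quad\text{for almost every }x\in U,$$ and that there is a countable set $E$ such that for each $x\in U\setminus E$ there is a constant $M_x>0$ with $$\mathsf{f}^{-}_{\phi,\theta}(x)\ge-M_x .$$ Then $\mathsf{f}$ is a positive measure in $U$: there is a positive Borel measure $\mu$, finite on compact subsets of $U$, such that $\langle \mathsf{f},\psi\rangle=\int\psi\,d\mu$ for every $\psi\in\mathcal{D}(\mathbb{R})$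 with $\operatorname{supp}\psi\subset U$. -/

import Mathlib

open MeasureTheory Filter Topology Set
open scoped Distributions LineDeriv

namespace LojDist

/-- The test function `u ↦ |ε|⁻¹ φ((u - x₀)/ε)`, for `ε ≠ 0`. (For `ε = 0` this is the zero
function; that value is never used.) -/
noncomputable def rescale (φ : 𝓓((⊤ : TopologicalSpace.Opens ℝ), ℝ)) (x₀ ε : ℝ) :
    𝓓((⊤ : TopologicalSpace.Opens ℝ), ℝ) where
  toFun u := |ε|⁻¹ * φ ((u - x₀) / ε)
  contDiff' := by
    have h := φ.contDiff
    have h2 : ContDiff ℝ ((⊤ : ℕ∞) : WithTop ℕ∞) (fun u : ℝ => (u - x₀) / ε) := by fun_prop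
    exact contDiff_const.mul (h.comp h2)
  hasCompactSupport' := by
    by_cases hε : ε = 0
    · have h0 : (fun u : ℝ => |ε|⁻¹ * φ ((u - x₀) / ε)) = 0 := by
        funext u
        simp [hε]
      rw [h0]
      exact HasCompactSupport.zero
    · have hc : HasCompactSupport (fun u : ℝ => φ ((u - x₀) / ε)) := by
        have h := φ.hasCompactSupport.comp_homeomorph
          ((Homeomorph.subRight x₀).trans (Homeomorph.mulRight₀ ε⁻¹ (inv_ne_zero hε)))
        have he : (fun u : ℝ => φ ((u - x₀) / ε)) = φ ∘
            ((Homeomorph.subRight x₀).trans (Homeomorph.mulRight₀ ε⁻¹ (inv_ne_zero hε))) := by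
          funext u
          simp [div_eq_mul_inv]
        rw [he]
        exact h
      exact hc.mul_left
  tsupport_subset' := by simp

/-- The evaluation `⟨f(x₀ + ε y), φ(y)⟩` of the affinely rescaled distribution (`ε ≠ 0`); by the
change of variables `u = x₀ + ε y` it is `⟨f(u), |ε|⁻¹ φ((u - x₀)/ε)⟩`. -/
noncomputable def rescaledEval (f : 𝓓'((⊤ : TopologicalSpace.Opens ℝ), ℝ)) (x₀ ε : ℝ)
    (φ : 𝓓((⊤ : TopologicalSpace.Opens ℝ), ℝ)) : ℝ :=
  f (rescale φ x₀ ε)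

/-- `f` has the Łojasiewicz (distributional) point value `γ` at `x₀`:
`lim_{ε → 0} ⟨f(x₀ + ε x), φ(x)⟩ = γ ∫ φ` for every test function `φ`. -/
def HasPointValue (f : 𝓓'((⊤ : TopologicalSpace.Opens ℝ), ℝ)) (x₀ γ : ℝ) : Prop :=
  ∀ φ : 𝓓((⊤ : TopologicalSpace.Opens ℝ), ℝ),
    Tendsto (fun ε : ℝ => rescaledEval f x₀ ε φ) (𝓝[≠] 0) (𝓝 (γ * ∫ x, φ x))

/-- A Łojasiewicz distribution: the distributional point value exists at every point. -/
def IsLojasiewicz (f : 𝓓'((⊤ : TopologicalSpace.Opens ℝ), ℝ)) : Prop :=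
  ∀ x₀ : ℝ, ∃ γ : ℝ, HasPointValue f x₀ γ

/-- The `φ`-transform `F(x, t) = ⟨f(x + t y), φ(y)⟩`, meant for `t > 0`. -/
noncomputable def phiTransform (f : 𝓓'((⊤ : TopologicalSpace.Opens ℝ), ℝ))
    (φ : 𝓓((⊤ : TopologicalSpace.Opens ℝ), ℝ)) (x t : ℝ) : ℝ :=
  rescaledEval f x t φ

/-- The cone `C_{x₀,θ}` of angle `θ` at `x₀` in the open upper half plane. -/
def cone (x₀ θ : ℝ) : Set (ℝ × ℝ) :=
  {p | 0 < p.2 ∧ |p.1 - x₀| ≤ Real.tan θ * p.2}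

/-- The upper angular value `f⁺_{φ,θ}(x₀)`, an extended real number; for `θ = 0` it is the upper
radial limit. -/
noncomputable def upperAngular (f : 𝓓'((⊤ : TopologicalSpace.Opens ℝ), ℝ))
    (φ : 𝓓((⊤ : TopologicalSpace.Opens ℝ), ℝ)) (θ x₀ : ℝ) : EReal :=
  limsup (fun p : ℝ × ℝ => (phiTransform f φ p.1 p.2 : EReal)) (𝓝[cone x₀ θ] (x₀, 0))

/-- The lower angular value `f⁻_{φ,θ}(x₀)`, an extended real number. -/
noncomputable def lowerAngular (f : 𝓓'((⊤ : TopologicalSpace.Opens ℝ), ℝ))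
    (φ : 𝓓((⊤ : TopologicalSpace.Opens ℝ), ℝ)) (θ x₀ : ℝ) : EReal :=
  liminf (fun p : ℝ × ℝ => (phiTransform f φ p.1 p.2 : EReal)) (𝓝[cone x₀ θ] (x₀, 0))

/-- `f` is a (positive Radon) measure in the open set `U`: there is a positive Borel measure,
finite on the compact subsets of `U`, against which `f` integrates all test functions supported
in `U`. -/
def IsMeasureOn (f : 𝓓'((⊤ : TopologicalSpace.Opens ℝ), ℝ)) (U : Set ℝ) : Prop :=
  ∃ μ : Measure ℝ, (∀ K : Set ℝ, IsCompact K → K ⊆ U → μ K < ⊤) ∧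
    ∀ ψ : 𝓓((⊤ : TopologicalSpace.Opens ℝ), ℝ), tsupport ψ ⊆ U → f ψ = ∫ x, ψ x ∂μ

end LojDist

/-!
Write `f ≥ 0` on an open set when `f` is nonnegative on the nonnegative test functions supported
there. By M. Riesz' extension theorem and the Riesz-Markov-Kakutani theorem
(`PosOn.exists_measure`), it suffices to show `f ≥ 0` on `U`. Let `W` be the largest open set on
which `f ≥ 0`; positivity is local (`posOn_of_locally`), so `W` is the set of points having a
neighborhood on which `f ≥ 0`. Suppose that `P = U \ W` is not empty. It is locally closed, hence a
Baire space, and it is covered by the closed sets `coneBoundSet n` of the points over which the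
`φ`-transform is at least `-(n + 1)` on a truncated cone, together with the singletons of points of
`E`. So one of these closed sets contains a relatively open portion of `P`.

If it is a singleton, `P` has an isolated point `p`, and `f ≥ 0` on a punctured neighborhood of `p`.
Since `F` has a point value at `p`, the distribution `f = F'` puts no mass on shrinking
neighborhoods of `p` (`tendsto_cutoff_of_hasPointValue`), so that `f ≥ 0` around `p`
(`posOn_ball_of_posOn_punctured`), a contradiction.

If it is a set `coneBoundSet n`, the `φ`-transform is at least `-(n + 1)` at all points `(x, t)` with
`x` in an interval around a point of `P` and `t` small: either `[x - Rt, x + Rt]` misses `P`, and the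
transform is nonnegative, or it meets `P` at some `p`, and `(x, t)` lies in the cone at `p` because
`R < tan θ`. The `φ`-transform being a mollification of `f`, it follows that `f + (n + 1) ≥ 0` on the
interval (`le_of_le_phiTransform`), so that `f + (n + 1)` is a measure there. By differentiation of
measures the `φ`-transform has a radial limit almost everywhere, namely the density of this measure
minus `n + 1`. The assumption on the upper radial limits says that the density is at least `n + 1`
almost everywhere, whence `f ≥ 0` (`posOn_of_posOn_addConst`), again a contradiction.

The analytic tool is `exists_jet_representation`: on test functions with supports in a fixed compact
interval, a distribution is a continuous linear functional of finitely many derivatives in the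
uniform norm. This lets distributions commute with Bochner integrals in a Banach space.
-/

namespace LojDist

open scoped BoundedContinuousFunction CompactlySupported ContDiff Manifold

/-! ### Distributions of finite order as functionals of jets -/

/-- The space of real test functions on the line. -/
abbrev TF : Type := 𝓓((⊤ : TopologicalSpace.Opens ℝ), ℝ)

theorem continuous_iteratedDeriv_testFunction (ψ : TF) (i : ℕ) :
    Continuous (iteratedDeriv i ψ) :=
  ψ.contDiff.continuous_iteratedDeriv i (by exact_mod_cast le_top)

theorem hasCompactSupport_iteratedDeriv_testFunction (ψ : TF) (i : ℕ) :
    HasCompactSupport (iteratedDeriv i ψ) := by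
  refine (ψ.hasCompactSupport.iteratedFDeriv (𝕜 := ℝ) i).mono' ?_
  intro x hx
  apply subset_tsupport
  intro h0
  apply hx
  simp [iteratedDeriv, h0]

theorem uniformContinuous_iteratedDeriv_testFunction (ψ : TF) (i : ℕ) :
    UniformContinuous (iteratedDeriv i ψ) :=
  (continuous_iteratedDeriv_testFunction ψ i).uniformContinuous_of_tendsto_cocompact
    (x := 0) (hasCompactSupport_iteratedDeriv_testFunction ψ i).is_zero_at_infty

/-- The `i`-th derivative of a test function as a bounded continuous function (the choice of the
bound is immaterial). -/
noncomputable def derivBCF (i : ℕ) (ψ : TF) : ℝ →ᵇ ℝ :=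
  BoundedContinuousFunction.ofNormedAddCommGroup (iteratedDeriv i ψ)
    (continuous_iteratedDeriv_testFunction ψ i)
    (Classical.choose ((continuous_iteratedDeriv_testFunction ψ i).bounded_above_of_compact_support
      (hasCompactSupport_iteratedDeriv_testFunction ψ i)))
    (Classical.choose_spec
      ((continuous_iteratedDeriv_testFunction ψ i).bounded_above_of_compact_support
      (hasCompactSupport_iteratedDeriv_testFunction ψ i)))

@[simp] theorem derivBCF_apply (i : ℕ) (ψ : TF) (x : ℝ) :
    derivBCF i ψ x = iteratedDeriv i ψ x := rfl

/-- The jet of order `N` of a test function: its derivatives of order at most `N`, in a Banach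
space whose norm is the `C^N` norm. -/
noncomputable def jet (N : ℕ) : TF →ₗ[ℝ] (Fin (N + 1) → ℝ →ᵇ ℝ) where
  toFun ψ i := derivBCF i ψ
  map_add' ψ χ := by
    funext i
    ext x
    have h1 : ContDiffAt ℝ (i : ℕ) ψ x :=
      (ψ.contDiff.of_le (by exact_mod_cast le_top)).contDiffAt
    have h2 : ContDiffAt ℝ (i : ℕ) χ x :=
      (χ.contDiff.of_le (by exact_mod_cast le_top)).contDiffAt
    have : (⇑(ψ + χ) : ℝ → ℝ) = ⇑ψ + ⇑χ := rfl
    simp only [derivBCF_apply, Pi.add_apply, BoundedContinuousFunction.add_apply, this]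
    rw [iteratedDeriv_add h1 h2]
  map_smul' c ψ := by
    funext i
    ext x
    have h1 : ContDiffAt ℝ (i : ℕ) ψ x :=
      (ψ.contDiff.of_le (by exact_mod_cast le_top)).contDiffAt
    have : (⇑(c • ψ) : ℝ → ℝ) = c • ⇑ψ := rfl
    simp only [derivBCF_apply, Pi.smul_apply, BoundedContinuousFunction.coe_smul, this,
      RingHom.id_apply]
    rw [iteratedDeriv_const_smul h1 c]

@[simp] theorem jet_apply (N : ℕ) (ψ : TF) (i : Fin (N + 1)) (x : ℝ) :
    jet N ψ i x = iteratedDeriv i ψ x := rfl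

theorem jet_injective (N : ℕ) : Function.Injective (jet N) := by
  intro ψ χ h
  ext x
  have := congrArg (fun g => g 0 x) h
  simpa using this

theorem norm_jet_le {N : ℕ} {ψ : TF} {C : ℝ} (hC : 0 ≤ C)
    (h : ∀ i ≤ N, ∀ x, |iteratedDeriv i ψ x| ≤ C) : ‖jet N ψ‖ ≤ C := by
  rw [pi_norm_le_iff_of_nonneg hC]
  intro i
  rw [BoundedContinuousFunction.norm_le hC]
  intro x
  exact h i (by omega) x

/-- A distribution has finite order on test functions supported in a fixed compact interval. -/
theorem exists_order_bound (f : 𝓓'((⊤ : TopologicalSpace.Opens ℝ), ℝ)) (a : ℝ) :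
    ∃ N : ℕ, ∃ C : ℝ, 0 ≤ C ∧ ∀ ψ : TF, tsupport ψ ⊆ Icc (-a) a → |f ψ| ≤ C * ‖jet N ψ‖ := by
  let K : TopologicalSpace.Compacts ℝ := ⟨Icc (-a) a, isCompact_Icc⟩
  have hK : (K : Set ℝ) ⊆ (⊤ : TopologicalSpace.Opens ℝ) := fun _ _ => trivial
  let g : 𝓓_{K}(ℝ, ℝ) →ₗ[ℝ] ℝ :=
    { toFun := fun ψ => f (TestFunction.ofSupportedIn hK ψ)
      map_add' := fun ψ χ =>
        map_add f (TestFunction.ofSupportedIn hK ψ) (TestFunction.ofSupportedIn hK χ)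
      map_smul' := fun c ψ => map_smul f c (TestFunction.ofSupportedIn hK ψ) }
  have hg : Continuous g :=
    f.continuous.comp (TestFunction.continuous_ofSupportedIn hK)
  obtain ⟨s, C, -, hC⟩ := Seminorm.bound_of_continuous
    (ContDiffMapSupportedIn.withSeminorms' ℝ ℝ ℝ ⊤ K) ((normSeminorm ℝ ℝ).comp g)
    (continuous_norm.comp hg)
  refine ⟨s.sup id, C, C.2, fun ψ hψ => ?_⟩
  let ψ' : 𝓓_{K}(ℝ, ℝ) := .of_support_subset ψ.contDiff ((subset_tsupport ψ).trans hψ)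
  have h1 := hC ψ'
  have h2 : ((normSeminorm ℝ ℝ).comp g) ψ' = |f ψ| := rfl
  rw [h2] at h1
  refine h1.trans ?_
  rw [smul_apply, NNReal.smul_def, smul_eq_mul]
  refine mul_le_mul_of_nonneg_left ?_ C.2
  refine Seminorm.finset_sup_apply_le (norm_nonneg _) fun i hi => ?_
  refine Seminorm.finset_sup_apply_le (norm_nonneg _) fun j hj => ?_
  rw [ContDiffMapSupportedIn.seminorm_top_le_iff ℝ (norm_nonneg _)]
  intro x _
  rw [norm_iteratedFDeriv_eq_norm_iteratedDeriv]
  have hj' : j < s.sup id + 1 := by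
    have := Finset.le_sup (f := id) hi
    have := Finset.mem_Iic.1 hj
    simp only [id] at *
    omega
  exact ((jet (s.sup id) ψ ⟨j, hj'⟩).norm_coe_le_norm x).trans
    (norm_le_pi_norm (jet (s.sup id) ψ) ⟨j, hj'⟩)

/-- On test functions supported in a fixed compact interval, a distribution is a continuous linear
functional of the jet. Since jets live in a Banach space, distributions thereby commute with
integrals. -/
theorem exists_jet_representation (f : 𝓓'((⊤ : TopologicalSpace.Opens ℝ), ℝ)) (a : ℝ) :
    ∃ N : ℕ, ∃ L : (Fin (N + 1) → ℝ →ᵇ ℝ) →L[ℝ] ℝ,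
      ∀ ψ : TF, tsupport ψ ⊆ Icc (-a) a → f ψ = L (jet N ψ) := by
  obtain ⟨N, C, hC, hb⟩ := exists_order_bound f a
  let S : Submodule ℝ TF :=
    { carrier := {ψ | tsupport ψ ⊆ Icc (-a) a}
      add_mem' := fun {ψ χ} hψ hχ => (tsupport_add _ _).trans (union_subset hψ hχ)
      zero_mem' := by
        have : (⇑(0 : TF) : ℝ → ℝ) = 0 := rfl
        simp [this, tsupport_zero]
      smul_mem' := fun c ψ hψ => (tsupport_smul_subset_right (fun _ => c) _).trans hψ }
  -- `f` descends to a bounded functional on the range of the jet map; extend it by Hahn-Banach.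
  have hinj : Function.Injective ((jet N).domRestrict S) :=
    (jet_injective N).comp Subtype.val_injective
  let e := LinearEquiv.ofInjective ((jet N).domRestrict S) hinj
  let fl : TF →ₗ[ℝ] ℝ := (f : TF →ₗ[ℝ] ℝ)
  let g : LinearMap.range ((jet N).domRestrict S) →ₗ[ℝ] ℝ :=
    (fl.domRestrict S).comp e.symm.toLinearMap
  have hg : ∀ v, ‖g v‖ ≤ C * ‖v‖ := by
    intro v
    obtain ⟨ψ, rfl⟩ := e.surjective v
    have h1 : g (e ψ) = f ψ := by
      simp [g, fl]
    rw [h1]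
    exact hb ψ ψ.2
  obtain ⟨L, hL, -⟩ := exists_extension_norm_eq (𝕜 := ℝ) _ (g.mkContinuous C hg)
  refine ⟨N, L, fun ψ hψ => ?_⟩
  have h2 := hL (e ⟨ψ, hψ⟩)
  have h3 : ((e ⟨ψ, hψ⟩ : LinearMap.range ((jet N).domRestrict S)) : Fin (N + 1) → ℝ →ᵇ ℝ)
      = jet N ψ := rfl
  rw [h3] at h2
  rw [h2]
  simp [g, fl]

/-! Translation of a test function by `x` is `rescale · x 1`. -/

@[simp] theorem rescale_apply (φ : TF) (x t u : ℝ) :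
    rescale φ x t u = |t|⁻¹ * φ ((u - x) / t) := rfl

theorem rescale_one_apply (φ : TF) (x u : ℝ) : rescale φ x 1 u = φ (u - x) := by
  simp

theorem iteratedDeriv_rescale_one (φ : TF) (x : ℝ) (i : ℕ) (u : ℝ) :
    iteratedDeriv i (rescale φ x 1) u = iteratedDeriv i φ (u - x) := by
  have : (⇑(rescale φ x 1) : ℝ → ℝ) = fun u => φ (u - x) := by
    funext u; exact rescale_one_apply φ x u
  rw [this, iteratedDeriv_comp_sub_const]

theorem continuous_jet_rescale_one (N : ℕ) (φ : TF) :
    Continuous fun x => jet N (rescale φ x 1) := by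
  refine continuous_pi fun i => ?_
  rw [Metric.continuous_iff]
  intro x ε hε
  obtain ⟨δ, hδ, h⟩ := Metric.uniformContinuous_iff.1
    (uniformContinuous_iteratedDeriv_testFunction φ i) (ε / 2) (half_pos hε)
  refine ⟨δ, hδ, fun y hy => lt_of_le_of_lt ?_ (half_lt_self hε)⟩
  rw [BoundedContinuousFunction.dist_le (half_pos hε).le]
  intro u
  rw [jet_apply, jet_apply, iteratedDeriv_rescale_one, iteratedDeriv_rescale_one]
  refine (h ?_).le
  rwa [dist_sub_left]

theorem tsupport_rescale_subset {φ : TF} {R : ℝ} (hR : tsupport φ ⊆ Icc (-R) R) (x : ℝ) {t : ℝ}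
    (ht : 0 < t) : tsupport (rescale φ x t) ⊆ Icc (x - R * t) (x + R * t) := by
  refine closure_minimal (fun u hu => ?_) isClosed_Icc
  have h1 : φ ((u - x) / t) ≠ 0 := by
    intro h0
    apply hu
    simp [h0]
  obtain ⟨h2, h3⟩ := hR (subset_tsupport _ h1)
  rw [le_div_iff₀ ht] at h2
  rw [div_le_iff₀ ht] at h3
  constructor <;> linarith

theorem rescale_eq_translate (φ : TF) (x t : ℝ) :
    rescale φ x t = rescale (rescale φ 0 t) x 1 := by
  ext u
  simp

theorem exists_tsupport_subset (φ : TF) : ∃ a : ℝ, 0 < a ∧ tsupport φ ⊆ Icc (-a) a := by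
  obtain ⟨a, ha⟩ := φ.hasCompactSupport.isBounded.subset_closedBall 0
  refine ⟨max a 1, by positivity, ha.trans ?_⟩
  rw [Real.closedBall_eq_Icc]
  exact Icc_subset_Icc (by simp) (by simp)

/-- The pairing of a distribution with the translates of a test function depends continuously on
the translation. -/
theorem continuous_translate_pairing (f : 𝓓'((⊤ : TopologicalSpace.Opens ℝ), ℝ)) (φ : TF) :
    Continuous fun x => f (rescale φ x 1) := by
  obtain ⟨a, ha, hφ⟩ := exists_tsupport_subset φ
  rw [continuous_iff_continuousAt]
  intro x₀
  obtain ⟨N, L, hL⟩ := exists_jet_representation f (|x₀| + 1 + a)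
  have h1 : ContinuousAt (fun x => L (jet N (rescale φ x 1))) x₀ :=
    (L.continuous.comp (continuous_jet_rescale_one N φ)).continuousAt
  refine h1.congr ?_
  filter_upwards [Metric.ball_mem_nhds x₀ one_pos] with x hx
  refine (hL _ ((tsupport_rescale_subset hφ x one_pos).trans (Icc_subset_Icc ?_ ?_))).symm <;>
  · rw [Metric.mem_ball, Real.dist_eq, abs_lt] at hx
    have := neg_abs_le x₀
    have := le_abs_self x₀
    linarith [hx.1, hx.2]

theorem continuous_phiTransform (f : 𝓓'((⊤ : TopologicalSpace.Opens ℝ), ℝ)) (φ : TF) (t : ℝ) :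
    Continuous fun x => phiTransform f φ x t := by
  have h := continuous_translate_pairing f (rescale φ 0 t)
  refine h.congr fun x => ?_
  rw [phiTransform, rescaledEval, rescale_eq_translate φ x t]

/-! ### Mollification of distributions -/

theorem hasDerivAt_iteratedDeriv_testFunction (ψ : TF) (i : ℕ) (x : ℝ) :
    HasDerivAt (iteratedDeriv i ψ) (iteratedDeriv (i + 1) ψ x) x := by
  rw [iteratedDeriv_succ]
  exact (ψ.contDiff.differentiable_iteratedDeriv i
    (by exact_mod_cast ENat.natCast_lt_top i)).differentiableAt.hasDerivAt

theorem integrable_iteratedDeriv_mul (a b : TF) (i j : ℕ) (u : ℝ) :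
    Integrable fun x => iteratedDeriv i a x * iteratedDeriv j b (u - x) := by
  refine Continuous.integrable_of_hasCompactSupport ?_ ?_
  · exact (continuous_iteratedDeriv_testFunction a i).mul
      ((continuous_iteratedDeriv_testFunction b j).comp (by fun_prop))
  · exact (hasCompactSupport_iteratedDeriv_testFunction a i).mul_right

theorem integral_iteratedDeriv_mul_succ (a b : TF) (i j : ℕ) (u : ℝ) :
    ∫ x, iteratedDeriv i a x * iteratedDeriv (j + 1) b (u - x) =
      ∫ x, iteratedDeriv (i + 1) a x * iteratedDeriv j b (u - x) := by
  have hv : ∀ x, HasDerivAt (fun x => iteratedDeriv j b (u - x))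
      (-iteratedDeriv (j + 1) b (u - x)) x := fun x =>
    (hasDerivAt_iteratedDeriv_testFunction b j (u - x)).comp_const_sub u x
  have := integral_mul_deriv_eq_deriv_mul_of_integrable
    (fun x _ => hasDerivAt_iteratedDeriv_testFunction a i x) (fun x _ => hv x)
    (by simpa [Pi.mul_def] using (integrable_iteratedDeriv_mul a b i (j + 1) u).neg)
    (integrable_iteratedDeriv_mul a b (i + 1) j u) (integrable_iteratedDeriv_mul a b i j u)
  simp only [mul_neg, integral_neg, neg_inj] at this
  exact this

/-- Integration by parts moves all derivatives in a convolution to one factor. -/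
theorem integral_mul_iteratedDeriv (a b : TF) (j i : ℕ) (u : ℝ) :
    ∫ x, iteratedDeriv i a x * iteratedDeriv j b (u - x) =
      ∫ x, iteratedDeriv (i + j) a x * b (u - x) := by
  induction j generalizing i with
  | zero => simp
  | succ j ih =>
    rw [integral_iteratedDeriv_mul_succ, ih (i + 1)]
    congr 3
    ring_nf

/-- Every derivative of a convolution may be put on either factor. -/
theorem integral_mul_iteratedDeriv_comm (a b : TF) (k : ℕ) (u : ℝ) :
    ∫ x, a x * iteratedDeriv k b (u - x) = ∫ x, b x * iteratedDeriv k a (u - x) := by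
  have h := integral_mul_iteratedDeriv a b k 0 u
  simp only [iteratedDeriv_zero, zero_add] at h
  rw [h, ← integral_sub_left_eq_self _ volume u]
  simp [mul_comm]

theorem integrable_smul_jet (a b : TF) (N : ℕ) :
    Integrable fun x => a x • jet N (rescale b x 1) :=
  (a.continuous.smul (continuous_jet_rescale_one N b)).integrable_of_hasCompactSupport
    a.hasCompactSupport.smul_right

theorem integral_smul_jet_apply (a b : TF) (N : ℕ) (i : Fin (N + 1)) (u : ℝ) :
    (∫ x, a x • jet N (rescale b x 1)) i u = ∫ x, a x * iteratedDeriv i b (u - x) := by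
  let ev : (Fin (N + 1) → ℝ →ᵇ ℝ) →L[ℝ] ℝ :=
    (BoundedContinuousFunction.evalCLM ℝ u).comp (ContinuousLinearMap.proj i)
  have h := ev.integral_comp_comm (integrable_smul_jet a b N)
  have h2 : ev (∫ x, a x • jet N (rescale b x 1)) =
    (∫ x, a x • jet N (rescale b x 1)) i u := rfl
  rw [← h2, ← h]
  refine integral_congr_ae (Eventually.of_forall fun x => ?_)
  have h3 : ev (a x • jet N (rescale b x 1)) = a x * jet N (rescale b x 1) i u := rfl
  simp only [h3, jet_apply, iteratedDeriv_rescale_one]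

/-- Smearing the translates of `b` by `a`, or those of `a` by `b`, gives the same test function
`a * b`, so that a distribution takes the same value on both. -/
theorem integral_mul_translate_comm (f : 𝓓'((⊤ : TopologicalSpace.Opens ℝ), ℝ)) (a b : TF) :
    ∫ x, a x * f (rescale b x 1) = ∫ x, b x * f (rescale a x 1) := by
  obtain ⟨p, hp, hap⟩ := exists_tsupport_subset a
  obtain ⟨q, hq, hbq⟩ := exists_tsupport_subset b
  obtain ⟨N, L, hL⟩ := exists_jet_representation f (p + q)
  have key : ∀ (a b : TF) (p q : ℝ), tsupport a ⊆ Icc (-p) p → tsupport b ⊆ Icc (-q) q →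
      (∀ ψ : TF, tsupport ψ ⊆ Icc (-(p + q)) (p + q) → f ψ = L (jet N ψ)) →
      ∫ x, a x * f (rescale b x 1) = L (∫ x, a x • jet N (rescale b x 1)) := by
    intro a b p q hap hbq hL
    rw [← L.integral_comp_comm (integrable_smul_jet a b N)]
    refine integral_congr_ae (Eventually.of_forall fun x => ?_)
    simp only [map_smul, smul_eq_mul]
    by_cases hx : a x = 0
    · simp [hx]
    · have hx' := hap (subset_tsupport _ hx)
      rw [hL _ ((tsupport_rescale_subset hbq x one_pos).trans (Icc_subset_Icc ?_ ?_))] <;>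
        linarith [hx'.1, hx'.2]
  rw [key a b p q hap hbq hL, key b a q p hbq hap (by rwa [add_comm q p])]
  congr 1
  funext i
  ext u
  rw [integral_smul_jet_apply, integral_smul_jet_apply, integral_mul_iteratedDeriv_comm]

theorem integral_rescale (φ : TF) (x : ℝ) {t : ℝ} (ht : t ≠ 0) :
    ∫ u, rescale φ x t u = ∫ u, φ u := by
  simp only [rescale_apply]
  rw [integral_const_mul, integral_sub_right_eq_self (fun u => φ (u / t)) x,
    Measure.integral_comp_div, smul_eq_mul, inv_mul_cancel_left₀ (abs_ne_zero.2 ht)]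

theorem integrable_testFunction (φ : TF) : Integrable (φ : ℝ → ℝ) :=
  φ.continuous.integrable_of_hasCompactSupport φ.hasCompactSupport

/-- If the `φ`-transform is at least `-M` at all small scales over `V`, then `f + M ≥ 0` on `V`:
the `φ`-transform at scale `t` is a mollification of `f`, which converges to `f` as `t → 0`. -/
theorem le_of_le_phiTransform (f : 𝓓'((⊤ : TopologicalSpace.Opens ℝ), ℝ)) (φ : TF)
    (hφ_pos : ∀ x : ℝ, 0 ≤ φ x) (hφ_int : ∫ x, φ x = 1) {V : Set ℝ} {M t₀ : ℝ} (ht₀ : 0 < t₀)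
    (h : ∀ x ∈ V, ∀ t, 0 < t → t < t₀ → -M ≤ phiTransform f φ x t)
    (ψ : TF) (hψ : ∀ x, 0 ≤ ψ x) (hψV : tsupport ψ ⊆ V) :
    0 ≤ f ψ + M * ∫ x, ψ x := by
  obtain ⟨R, hR, hφR⟩ := exists_tsupport_subset φ
  refine le_of_forall_pos_le_add fun ε hε => ?_
  obtain ⟨δ, hδ, hc⟩ := Metric.continuous_iff.1 (continuous_translate_pairing f ψ) 0 ε hε
  have hψ0 : rescale ψ 0 1 = ψ := by ext; simp
  rw [hψ0] at hc
  -- For `R t < δ`, the dilate of `φ` only sees translates of `ψ` whose pairing with `f` is within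
  -- `ε` of `f ψ`.
  obtain ⟨t, ht, ht1⟩ := exists_between (lt_min ht₀ (div_pos hδ hR))
  have htδ : R * t < δ := by
    have := ht1.trans_le (min_le_right _ _)
    rw [lt_div_iff₀ hR] at this
    linarith
  have hsupp := tsupport_rescale_subset hφR 0 ht
  have hcomm := integral_mul_translate_comm f ψ (rescale φ 0 t)
  simp only [← rescale_eq_translate] at hcomm
  have hi1 : Integrable fun x => ψ x * f (rescale φ x t) :=
    (ψ.continuous.mul (continuous_phiTransform f φ t)).integrable_of_hasCompactSupport
      ψ.hasCompactSupport.mul_right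
  have hi2 : Integrable fun x => rescale φ 0 t x * f (rescale ψ x 1) :=
    ((rescale φ 0 t).continuous.mul
      (continuous_translate_pairing f ψ)).integrable_of_hasCompactSupport
      (rescale φ 0 t).hasCompactSupport.mul_right
  have h1 : ∫ x, ψ x * -M ≤ ∫ x, ψ x * f (rescale φ x t) := by
    refine integral_mono ((integrable_testFunction ψ).mul_const _) hi1 fun x => ?_
    by_cases hx : ψ x = 0
    · simp [hx]
    · exact mul_le_mul_of_nonneg_left
        (h x (hψV (subset_tsupport _ hx)) t ht (ht1.trans_le (min_le_left _ _))) (hψ x)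
  have h2 : ∫ x, rescale φ 0 t x * f (rescale ψ x 1) ≤ ∫ x, rescale φ 0 t x * (f ψ + ε) := by
    refine integral_mono hi2 ((integrable_testFunction _).mul_const _) fun x => ?_
    by_cases hx : rescale φ 0 t x = 0
    · simp only [hx, zero_mul, le_refl]
    · have hx' := hsupp (subset_tsupport _ hx)
      have hd : dist x 0 < δ := by
        rw [Real.dist_eq, abs_lt]
        constructor <;> linarith [hx'.1, hx'.2]
      have := (abs_lt.1 (hc x hd)).2
      exact mul_le_mul_of_nonneg_left (by linarith)
        (mul_nonneg (inv_nonneg.2 (abs_nonneg _)) (hφ_pos _))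
  rw [integral_mul_const] at h1 h2
  rw [integral_rescale φ 0 ht.ne', hφ_int] at h2
  linarith

/-! ### Positive distributions are measures -/

/-- A linear functional on test functions is positive on `V` if it is nonnegative on the
nonnegative test functions supported in `V`. -/
def PosOn (Λ : TF →ₗ[ℝ] ℝ) (V : Set ℝ) : Prop :=
  ∀ ψ : TF, (∀ x, 0 ≤ ψ x) → tsupport ψ ⊆ V → 0 ≤ Λ ψ

theorem PosOn.mono {Λ : TF →ₗ[ℝ] ℝ} {V W : Set ℝ} (h : PosOn Λ V) (hWV : W ⊆ V) : PosOn Λ W :=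
  fun ψ hψ hs => h ψ hψ (hs.trans hWV)

theorem exists_cutoff {K U : Set ℝ} (hK : IsCompact K) (hU : IsOpen U) (hKU : K ⊆ U) :
    ∃ χ : TF, (∀ᶠ x in 𝓝ˢ K, χ x = 1) ∧ (∀ x, 0 ≤ χ x) ∧ (∀ x, χ x ≤ 1) ∧ tsupport χ ⊆ U := by
  obtain ⟨K', hK', hKK', hK'U⟩ := exists_compact_between hK hU hKU
  obtain ⟨g, hg1, hg0, hg⟩ :=
    exists_contMDiffMap_one_nhds_of_subset_interior (n := ⊤) 𝓘(ℝ, ℝ) hK.isClosed hKK'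
  have hs : tsupport g ⊆ K' := by
    refine closure_minimal (fun x hx => ?_) hK'.isClosed
    by_contra h
    exact hx (hg0 x h)
  have hc : HasCompactSupport g := hK'.of_isClosed_subset (isClosed_tsupport _) hs
  exact ⟨⟨g, g.contMDiff.contDiff, hc, fun _ _ => trivial⟩, hg1, fun x => (hg x).1,
    fun x => (hg x).2, hs.trans hK'U⟩

/-- A linear functional on test functions that is positive on an open set `U` is integration
against a measure there: M. Riesz' theorem extends it to a positive functional on `C_c(U)`. -/
theorem PosOn.exists_measure {Λ : TF →ₗ[ℝ] ℝ} {U : Set ℝ} (hU : IsOpen U) (hΛ : PosOn Λ U) :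
    ∃ μ : Measure ℝ, (∀ K : Set ℝ, IsCompact K → K ⊆ U → μ K < ⊤) ∧
      ∀ ψ : TF, tsupport ψ ⊆ U → Λ ψ = ∫ x, ψ x ∂μ := by
  have : LocallyCompactSpace U := hU.locallyCompactSpace
  have hcpt : ∀ K : Set ℝ, IsCompact K → K ⊆ U → IsCompact ((↑) ⁻¹' K : Set U) := fun K hK hKU =>
    Topology.IsInducing.subtypeVal.isCompact_preimage' hK (by simpa using hKU)
  let S : Submodule ℝ TF :=
    { carrier := {ψ | tsupport ψ ⊆ U}
      add_mem' := fun {ψ χ} hψ hχ => (tsupport_add _ _).trans (union_subset hψ hχ)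
      zero_mem' := by
        have : (⇑(0 : TF) : ℝ → ℝ) = 0 := rfl
        simp [this, tsupport_zero]
      smul_mem' := fun c ψ hψ => (tsupport_smul_subset_right (fun _ => c) _).trans hψ }
  let r : S →ₗ[ℝ] C_c(U, ℝ) :=
    { toFun := fun ψ =>
        { toFun := fun x => (ψ : TF) x
          continuous_toFun := (ψ : TF).continuous.comp continuous_subtype_val
          hasCompactSupport' := HasCompactSupport.intro
            (hcpt _ (ψ : TF).hasCompactSupport ψ.2) fun x hx =>
              image_eq_zero_of_notMem_tsupport hx }
      map_add' := fun _ _ => rfl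
      map_smul' := fun _ _ => rfl }
  have hr : ∀ (ψ : S) (x : U), r ψ x = (ψ : TF) x := fun _ _ => rfl
  have hinj : Function.Injective r := by
    intro ψ χ h
    ext x
    by_cases hx : x ∈ U
    · exact congrArg (fun g : C_c(U, ℝ) => g ⟨x, hx⟩) h
    · rw [image_eq_zero_of_notMem_tsupport fun h' => hx (ψ.2 h'),
        image_eq_zero_of_notMem_tsupport fun h' => hx (χ.2 h')]
  let e := LinearEquiv.ofInjective r hinj
  let P : PointedCone ℝ C_c(U, ℝ) :=
    { carrier := {g | ∀ x, 0 ≤ g x}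
      add_mem' := fun hg hh x => add_nonneg (hg x) (hh x)
      zero_mem' := fun x => le_rfl
      smul_mem' := fun c g hg x => mul_nonneg c.2 (hg x) }
  let p : C_c(U, ℝ) →ₗ.[ℝ] ℝ := ⟨LinearMap.range r, (Λ.domRestrict S).comp e.symm.toLinearMap⟩
  have hpe : ∀ ψ : S, p (e ψ) = Λ ψ := by
    intro ψ
    have h1 : p (e ψ) = Λ.domRestrict S (e.symm (e ψ)) := rfl
    rw [h1, e.symm_apply_apply, LinearMap.domRestrict_apply]
  obtain ⟨g, hg, hgpos⟩ := riesz_extension P p (by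
      intro v hv
      obtain ⟨ψ, rfl⟩ := e.surjective v
      rw [hpe]
      refine hΛ ψ (fun x => ?_) ψ.2
      by_cases hx : x ∈ U
      · exact hv ⟨x, hx⟩
      · rw [image_eq_zero_of_notMem_tsupport fun h' => hx (ψ.2 h')]) (by
      intro y
      obtain ⟨C, hC⟩ := y.continuous.bounded_above_of_compact_support y.hasCompactSupport
      have hK : IsCompact ((↑) '' tsupport y : Set ℝ) :=
        IsCompact.image y.hasCompactSupport continuous_subtype_val
      obtain ⟨χ, hχ1, hχ0, -, hχU⟩ := exists_cutoff hK hU (by rintro _ ⟨x, -, rfl⟩; exact x.2)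
      -- A multiple of a cutoff dominates `y`.
      refine ⟨e (C • ⟨χ, hχU⟩), fun x => ?_⟩
      have h1 : ((e (C • ⟨χ, hχU⟩) : LinearMap.range r) : C_c(U, ℝ)) x = C * χ x := rfl
      have hC0 : 0 ≤ C := (norm_nonneg _).trans (hC x)
      change 0 ≤ ((e (C • ⟨χ, hχU⟩) : LinearMap.range r) : C_c(U, ℝ)) x + y x
      rw [h1]
      by_cases hx : x ∈ tsupport y
      · rw [hχ1.self_of_nhdsSet x ⟨x, hx, rfl⟩]
        have : -C ≤ y x := (abs_le.1 (hC x)).1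
        linarith
      · rw [image_eq_zero_of_notMem_tsupport hx]
        have := mul_nonneg hC0 (hχ0 x)
        linarith)
  let Γ : C_c(U, ℝ) →ₚ[ℝ] ℝ := PositiveLinearMap.mk₀ g fun x hx => hgpos x hx
  refine ⟨(RealRMK.rieszMeasure Γ).map (↑), fun K hK hKU => ?_, fun ψ hψ => ?_⟩
  · rw [Measure.map_apply measurable_subtype_coe hK.measurableSet]
    exact (hcpt K hK hKU).measure_lt_top
  · rw [(MeasurableEmbedding.subtype_coe hU.measurableSet).integral_map]
    have h1 := RealRMK.integral_rieszMeasure Γ (r ⟨ψ, hψ⟩)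
    simp only [hr] at h1
    rw [h1]
    have h2 := hg (e ⟨ψ, hψ⟩)
    rw [hpe] at h2
    exact h2.symm

/-! ### Radial limits almost everywhere -/

/-- Integration against the kernel `|t|⁻¹ φ((u - x) / t)` is dominated by a multiple of the average
over the ball of radius `R t`. -/
theorem abs_integral_rescale_mul_le {φ : TF} {R C : ℝ} (hR : tsupport φ ⊆ Icc (-R) R)
    (hC : ∀ x, |φ x| ≤ C) (σ : Measure ℝ) (g : ℝ → ℝ) (x : ℝ) {t : ℝ} (ht : 0 < t)
    (hg : IntegrableOn g (Metric.closedBall x (R * t)) σ) :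
    |∫ u, rescale φ x t u * g u ∂σ| ≤
      C / t * ∫ u in Metric.closedBall x (R * t), |g u| ∂σ := by
  have hsupp := tsupport_rescale_subset hR x ht
  rw [← Real.closedBall_eq_Icc] at hsupp
  rw [← integral_const_mul, ← Real.norm_eq_abs]
  refine (norm_integral_le_integral_norm _).trans ?_
  rw [← setIntegral_eq_integral_of_forall_compl_eq_zero (s := Metric.closedBall x (R * t))]
  · refine integral_mono_of_nonneg (Eventually.of_forall fun u => norm_nonneg _)
      (hg.abs.const_mul _) (Eventually.of_forall fun u => ?_)
    simp only [norm_mul, Real.norm_eq_abs]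
    refine mul_le_mul_of_nonneg_right ?_ (abs_nonneg _)
    rw [rescale_apply, abs_mul, abs_of_pos ht, abs_of_pos (inv_pos.2 ht), div_eq_inv_mul C t]
    exact mul_le_mul_of_nonneg_left (hC _) (inv_pos.2 ht).le
  · intro u hu
    rw [image_eq_zero_of_notMem_tsupport fun h => hu (hsupp h)]
    simp

theorem tendsto_mul_nhdsGT_zero {R : ℝ} (hR : 0 < R) :
    Tendsto (fun t : ℝ => R * t) (𝓝[>] 0) (𝓝[>] 0) := by
  refine tendsto_nhdsWithin_iff.2 ⟨?_, ?_⟩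
  · have : Tendsto (fun t : ℝ => R * t) (𝓝 0) (𝓝 (R * 0)) :=
      (continuous_const.mul continuous_id).tendsto 0
    rw [mul_zero] at this
    exact this.mono_left nhdsWithin_le_nhds
  · filter_upwards [self_mem_nhdsWithin] with t ht using mul_pos hR ht

theorem exists_abs_le (φ : TF) : ∃ C, ∀ x, |φ x| ≤ C :=
  φ.continuous.bounded_above_of_compact_support φ.hasCompactSupport

/-- Mollifications of a singular measure tend to zero almost everywhere. -/
theorem ae_tendsto_integral_rescale_singularPart (φ : TF) (ν : Measure ℝ) [IsFiniteMeasure ν] :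
    ∀ᵐ x : ℝ, Tendsto (fun t => ∫ u, rescale φ x t u ∂(ν.singularPart volume)) (𝓝[>] 0)
      (𝓝 0) := by
  obtain ⟨R, hR, hφR⟩ := exists_tsupport_subset φ
  obtain ⟨C, hC⟩ := exists_abs_le φ
  set σ := ν.singularPart volume with hσ
  filter_upwards [Besicovitch.ae_tendsto_rnDeriv σ volume, ν.rnDeriv_singularPart volume]
    with x hx hx0
  rw [hx0, Pi.zero_apply] at hx
  have h1 := ((ENNReal.tendsto_toReal ENNReal.zero_ne_top).comp hx).comp
    (tendsto_mul_nhdsGT_zero hR)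
  have h2 := h1.const_mul (C * (2 * R))
  rw [ENNReal.toReal_zero, mul_zero] at h2
  refine squeeze_zero_norm' ?_ h2
  filter_upwards [self_mem_nhdsWithin] with t ht
  have ht : 0 < t := ht
  have h3 := abs_integral_rescale_mul_le hφR hC σ (fun _ => 1) x ht
    (integrableOn_const (measure_ne_top _ _))
  simp only [mul_one, abs_one, setIntegral_const, smul_eq_mul] at h3
  rw [Real.norm_eq_abs]
  refine h3.trans (le_of_eq ?_)
  simp only [Function.comp_apply, ENNReal.toReal_div, Real.volume_closedBall]
  rw [ENNReal.toReal_ofReal (by positivity), Measure.real]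
  field_simp

/-- Mollifications of an integrable function converge to it almost everywhere. -/
theorem ae_tendsto_integral_rescale_mul (φ : TF) (hφ_int : ∫ x, φ x = 1) {w : ℝ → ℝ}
    (hw : Integrable w) :
    ∀ᵐ x : ℝ, Tendsto (fun t => ∫ u, rescale φ x t u * w u) (𝓝[>] 0) (𝓝 (w x)) := by
  obtain ⟨R, hR, hφR⟩ := exists_tsupport_subset φ
  obtain ⟨C, hC⟩ := exists_abs_le φ
  filter_upwards [(Besicovitch.vitaliFamily volume).ae_tendsto_average_norm_sub
    hw.locallyIntegrable] with x hx
  have h1 := (hx.comp (Besicovitch.tendsto_filterAt volume x)).comp (tendsto_mul_nhdsGT_zero hR)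
  have h2 := h1.const_mul (C * (2 * R))
  rw [mul_zero] at h2
  rw [tendsto_iff_norm_sub_tendsto_zero]
  refine squeeze_zero' (Eventually.of_forall fun t => norm_nonneg _) ?_ h2
  filter_upwards [self_mem_nhdsWithin] with t ht
  have ht : 0 < t := ht
  have hi : ∀ g : ℝ → ℝ, LocallyIntegrable g → Integrable fun u => rescale φ x t u * g u := by
    intro g hg
    simpa using! hg.integrable_smul_left_of_hasCompactSupport (rescale φ x t).continuous
      (rescale φ x t).hasCompactSupport
  have hcl : LocallyIntegrable fun _ : ℝ => w x := continuous_const.locallyIntegrable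
  have h3 := abs_integral_rescale_mul_le hφR hC volume (fun u => w u - w x) x ht
    ((hw.locallyIntegrable.sub hcl).integrableOn_isCompact
      (isCompact_closedBall _ _))
  have h4 : ∫ u, rescale φ x t u * (w u - w x) = (∫ u, rescale φ x t u * w u) - w x := by
    simp only [mul_sub]
    rw [integral_sub (hi _ hw.locallyIntegrable) (hi _ hcl), integral_mul_const,
      integral_rescale φ x ht.ne', hφ_int, one_mul]
  rw [h4] at h3
  rw [Real.norm_eq_abs]
  refine h3.trans (le_of_eq ?_)
  simp only [Function.comp_apply, setAverage_eq, Measure.real, Real.volume_closedBall,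
    smul_eq_mul, Real.norm_eq_abs]
  rw [ENNReal.toReal_ofReal (by positivity)]
  field_simp

/-- Mollifications of a finite measure converge almost everywhere to its density. -/
theorem ae_tendsto_integral_rescale_measure (φ : TF) (hφ_int : ∫ x, φ x = 1) (ν : Measure ℝ)
    [IsFiniteMeasure ν] :
    ∀ᵐ x : ℝ, Tendsto (fun t => ∫ u, rescale φ x t u ∂ν) (𝓝[>] 0)
      (𝓝 (ν.rnDeriv volume x).toReal) := by
  filter_upwards [ae_tendsto_integral_rescale_singularPart φ ν,
    ae_tendsto_integral_rescale_mul φ hφ_int (Measure.integrable_toReal_rnDeriv (μ := ν)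
      (ν := volume))] with x h1 h2
  have h3 := h1.add h2
  rw [zero_add] at h3
  refine h3.congr fun t => ?_
  have hi : ∀ ρ : Measure ℝ, IsFiniteMeasure ρ → Integrable (rescale φ x t) ρ := fun ρ _ =>
    (rescale φ x t).continuous.integrable_of_hasCompactSupport (rescale φ x t).hasCompactSupport
  have h4 : ∫ u, rescale φ x t u ∂(volume.withDensity (ν.rnDeriv volume)) =
      ∫ u, rescale φ x t u * (ν.rnDeriv volume u).toReal := by
    rw [integral_withDensity_eq_integral_toReal_smul (Measure.measurable_rnDeriv _ _)
      (Measure.rnDeriv_lt_top _ _)]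
    simp only [smul_eq_mul, mul_comm]
  conv_rhs => rw [← ν.singularPart_add_rnDeriv volume]
  rw [integral_add_measure (hi _ inferInstance) (hi _ inferInstance), h4]

/-- An upper radial limit that is at least `0` forces a genuine radial limit to be so. -/
theorem nonneg_of_upperAngular_zero {f : 𝓓'((⊤ : TopologicalSpace.Opens ℝ), ℝ)} {φ : TF} {x L : ℝ}
    (h : 0 ≤ upperAngular f φ 0 x)
    (hL : Tendsto (fun t => phiTransform f φ x t) (𝓝[>] 0) (𝓝 L)) : 0 ≤ L := by
  by_contra! hneg
  have h1 : ∀ᶠ t in 𝓝[>] (0 : ℝ), phiTransform f φ x t < L / 2 :=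
    hL.eventually (gt_mem_nhds (by linarith))
  have h2 : Tendsto (fun p : ℝ × ℝ => p.2) (𝓝[cone x 0] (x, 0)) (𝓝[>] 0) := by
    refine tendsto_nhdsWithin_iff.2 ⟨?_, ?_⟩
    · exact (continuous_snd.tendsto (x, (0 : ℝ))).mono_left nhdsWithin_le_nhds
    · filter_upwards [self_mem_nhdsWithin] with p hp using hp.1
  have h3 : ∀ᶠ p : ℝ × ℝ in 𝓝[cone x 0] (x, 0),
      (phiTransform f φ p.1 p.2 : EReal) ≤ ((L / 2 : ℝ) : EReal) := by
    filter_upwards [h2.eventually h1, self_mem_nhdsWithin] with p hp hpc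
    have hx : p.1 = x := by
      have := hpc.2
      rw [Real.tan_zero, zero_mul] at this
      linarith [abs_nonpos_iff.1 this]
    rw [hx]
    exact_mod_cast hp.le
  have h4 : upperAngular f φ 0 x ≤ ((L / 2 : ℝ) : EReal) := limsup_le_of_le (by isBoundedDefault) h3
  have h5 : (0 : EReal) ≤ ((L / 2 : ℝ) : EReal) := h.trans h4
  have h6 : (0 : ℝ) ≤ L / 2 := by exact_mod_cast h5
  linarith

/-- Integration against Lebesgue measure, as a linear functional on test functions. -/
noncomputable def integralLM : TF →ₗ[ℝ] ℝ where
  toFun ψ := ∫ x, ψ x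
  map_add' ψ χ := integral_add (integrable_testFunction ψ) (integrable_testFunction χ)
  map_smul' c ψ := integral_const_mul c (fun x => ψ x)

/-- The linear functional `f + M`; `addConst f 0` is `f` without its continuity. -/
noncomputable def addConst (f : 𝓓'((⊤ : TopologicalSpace.Opens ℝ), ℝ)) (M : ℝ) : TF →ₗ[ℝ] ℝ :=
  (f : TF →ₗ[ℝ] ℝ) + M • integralLM

theorem addConst_apply (f : 𝓓'((⊤ : TopologicalSpace.Opens ℝ), ℝ)) (M : ℝ) (ψ : TF) :
    addConst f M ψ = f ψ + M * ∫ x, ψ x := rfl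

/-- If `f + M` is positive and the upper radial limits of the `φ`-transform of `f` are almost
everywhere nonnegative, then `f` is positive: the measure `f + M` has density at least `M`. -/
theorem posOn_of_posOn_addConst {f : 𝓓'((⊤ : TopologicalSpace.Opens ℝ), ℝ)} {φ : TF}
    (hφ_int : ∫ x, φ x = 1) {x₀ r M : ℝ} (hr : 0 < r)
    (hM : PosOn (addConst f M) (Metric.ball x₀ (2 * r)))
    (hup : ∀ᵐ x : ℝ, x ∈ Metric.ball x₀ r → 0 ≤ upperAngular f φ 0 x) :
    PosOn (addConst f 0) (Metric.ball x₀ r) := by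
  obtain ⟨ν₀, hfin, hν₀⟩ := hM.exists_measure Metric.isOpen_ball
  obtain ⟨R, hR, hφR⟩ := exists_tsupport_subset φ
  -- Restricting to an intermediate closed ball makes the measure finite.
  set B := Metric.closedBall x₀ (3 / 2 * r) with hB
  have hB2 : B ⊆ Metric.ball x₀ (2 * r) := Metric.closedBall_subset_ball (by linarith)
  set ν := ν₀.restrict B with hν
  have : IsFiniteMeasure ν :=
    isFiniteMeasure_restrict.2 (hfin B (isCompact_closedBall _ _) hB2).ne
  have hνψ : ∀ ψ : TF, tsupport ψ ⊆ B → f ψ = ∫ x, ψ x ∂ν - M * ∫ x, ψ x := by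
    intro ψ hψ
    have h1 := hν₀ ψ (hψ.trans hB2)
    rw [addConst_apply] at h1
    rw [hν, setIntegral_eq_integral_of_forall_compl_eq_zero fun x hx =>
      image_eq_zero_of_notMem_tsupport fun h => hx (hψ h), ← h1]
    ring
  have hdens : ∀ᵐ x : ℝ, x ∈ Metric.ball x₀ r → M ≤ (ν.rnDeriv volume x).toReal := by
    filter_upwards [hup, ae_tendsto_integral_rescale_measure φ hφ_int ν] with x hx1 hx2 hx
    have h1 : Tendsto (fun t => phiTransform f φ x t) (𝓝[>] 0)
        (𝓝 ((ν.rnDeriv volume x).toReal - M)) := by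
      refine (hx2.sub_const M).congr' ?_
      filter_upwards [Ioo_mem_nhdsGT (show (0 : ℝ) < r / (2 * R) by positivity)] with t ht
      have hsupp := tsupport_rescale_subset hφR x ht.1
      rw [← Real.closedBall_eq_Icc] at hsupp
      rw [phiTransform, rescaledEval, hνψ, integral_rescale φ x ht.1.ne', hφ_int, mul_one]
      refine hsupp.trans (Metric.closedBall_subset_closedBall' ?_)
      have h2 := ht.2
      rw [lt_div_iff₀ (by positivity)] at h2
      have h3 := Metric.mem_ball.1 hx
      linarith
    linarith [nonneg_of_upperAngular_zero (hx1 hx) h1]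
  intro ψ hψ hψs
  have hψB : tsupport ψ ⊆ B :=
    hψs.trans (Metric.ball_subset_closedBall.trans (Metric.closedBall_subset_closedBall
      (by linarith)))
  rw [addConst_apply, zero_mul, add_zero, hνψ ψ hψB]
  have hi : Integrable ψ ν :=
    ψ.continuous.integrable_of_hasCompactSupport ψ.hasCompactSupport
  have hle := Measure.withDensity_rnDeriv_le ν volume
  have h1 : ∫ x, ψ x ∂(volume.withDensity (ν.rnDeriv volume)) ≤ ∫ x, ψ x ∂ν :=
    integral_mono_measure hle (Eventually.of_forall hψ) hi
  rw [integral_withDensity_eq_integral_toReal_smul (Measure.measurable_rnDeriv _ _)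
      (Measure.rnDeriv_lt_top _ _)] at h1
  have hi2 : Integrable (fun x => (ν.rnDeriv volume x).toReal • ψ x) :=
    (integrable_withDensity_iff_integrable_smul' (Measure.measurable_rnDeriv _ _)
      (Measure.rnDeriv_lt_top _ _)).1 (hi.mono_measure hle)
  have h2 : ∫ x, M * ψ x ≤ ∫ x, (ν.rnDeriv volume x).toReal • ψ x := by
    refine integral_mono_ae ((integrable_testFunction ψ).const_mul M) hi2 ?_
    filter_upwards [hdens] with x hx
    by_cases h0 : ψ x = 0
    · simp [h0]
    · exact mul_le_mul_of_nonneg_right (hx (hψs (subset_tsupport _ h0))) (hψ x)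
  rw [integral_const_mul] at h2
  linarith

/-! ### Dilated test functions at a point value -/

/-- The product of a smooth function and a test function. -/
noncomputable def smoothMul (g : ℝ → ℝ) (hg : ContDiff ℝ ∞ g) (η : TF) : TF where
  toFun x := g x * η x
  contDiff' := hg.mul η.contDiff
  hasCompactSupport' := η.hasCompactSupport.mul_left
  tsupport_subset' := fun _ _ => trivial

@[simp] theorem smoothMul_apply (g : ℝ → ℝ) (hg : ContDiff ℝ ∞ g) (η : TF) (x : ℝ) :
    smoothMul g hg η x = g x * η x := rfl

theorem tsupport_smoothMul_subset (g : ℝ → ℝ) (hg : ContDiff ℝ ∞ g) (η : TF) :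
    tsupport (smoothMul g hg η) ⊆ tsupport η :=
  closure_mono fun x hx h0 => hx (by rw [smoothMul_apply, h0, mul_zero])

theorem lineDeriv_testFunction_apply (χ : TF) (x : ℝ) : (∂_{(1 : ℝ)} χ : TF) x = deriv χ x := by
  have h : (∂_{(1 : ℝ)} χ : TF) = TestFunction.lineDerivCLM ℝ (1 : ℝ) χ := rfl
  rw [h, TestFunction.lineDerivCLM_eq_fderivCLM, TestFunction.fderivCLM_apply, if_pos (by simp)]
  exact fderiv_apply_one_eq_deriv

theorem hasDerivAt_testFunction (χ : TF) (x : ℝ) : HasDerivAt χ (deriv χ x) x :=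
  (χ.contDiff.differentiable (by simp)).differentiableAt.hasDerivAt

theorem integral_lineDeriv_testFunction (χ : TF) : ∫ x, (∂_{(1 : ℝ)} χ : TF) x = 0 := by
  have hi := integrable_testFunction (∂_{(1 : ℝ)} χ : TF)
  simp only [lineDeriv_testFunction_apply] at hi ⊢
  refine integral_eq_zero_of_hasDerivAt_of_integrable (hasDerivAt_testFunction χ) ?_
    (integrable_testFunction χ)
  exact hi.congr (Eventually.of_forall fun x => lineDeriv_testFunction_apply χ x)

theorem lineDeriv_rescale (χ : TF) (p : ℝ) {ε : ℝ} (hε : 0 < ε) :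
    ∂_{(1 : ℝ)} (ε • rescale χ p ε) = rescale (∂_{(1 : ℝ)} χ) p ε := by
  ext u
  rw [lineDeriv_testFunction_apply, rescale_apply, lineDeriv_testFunction_apply]
  have h1 : (⇑(ε • rescale χ p ε) : ℝ → ℝ) = fun u => χ ((u - p) / ε) := by
    funext u
    change ε * (|ε|⁻¹ * χ ((u - p) / ε)) = _
    rw [abs_of_pos hε, mul_inv_cancel_left₀ hε.ne']
  rw [h1]
  have h2 : HasDerivAt (fun u => (u - p) / ε) (1 / ε) u :=
    ((hasDerivAt_id u).sub_const p).div_const ε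
  have h3 := (hasDerivAt_testFunction χ ((u - p) / ε)).comp u h2
  have h4 := h3.deriv
  simp only [Function.comp_def] at h4
  rw [h4, abs_of_pos hε]
  ring

/-- If `F` has a point value at `p`, the action of `F'` on the dilates `χ((u - p) / ε)` of a test
function tends to zero: it is `-⟨F(p + εy), χ'(y)⟩`, and `∫ χ' = 0`. -/
theorem tendsto_deriv_dilate {F : 𝓓'((⊤ : TopologicalSpace.Opens ℝ), ℝ)} {p γ : ℝ}
    (hF : HasPointValue F p γ) (χ : TF) :
    Tendsto (fun ε => ε * (∂_{(1 : ℝ)} F) (rescale χ p ε)) (𝓝[>] 0) (𝓝 0) := by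
  have h1 := (hF (∂_{(1 : ℝ)} χ)).neg.mono_left (nhdsGT_le_nhdsNE (0 : ℝ))
  rw [integral_lineDeriv_testFunction, mul_zero, neg_zero] at h1
  refine h1.congr' ?_
  filter_upwards [self_mem_nhdsWithin] with ε hε
  rw [rescaledEval, ← lineDeriv_rescale χ p hε, ← smul_eq_mul, ← map_smul,
    Distribution.lineDerivOp_apply_apply, map_neg]

/-- Taylor's estimate, with derivatives, for a smooth function vanishing to order `n` at `p`. -/
theorem exists_iteratedDeriv_bound_of_vanishing (n : ℕ) (p : ℝ) :
    ∀ g : ℝ → ℝ, ContDiff ℝ ∞ g → (∀ j < n, iteratedDeriv j g p = 0) →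
      ∃ C, 0 ≤ C ∧ ∀ i ≤ n, ∀ u ∈ Metric.closedBall p 1,
        |iteratedDeriv i g u| ≤ C * |u - p| ^ (n - i) := by
  induction n with
  | zero =>
    intro g hg _
    obtain ⟨C, hC⟩ :=
      (isCompact_closedBall p 1).exists_bound_of_continuousOn hg.continuous.continuousOn
    refine ⟨max C 0, le_max_right _ _, fun i hi u hu => ?_⟩
    obtain rfl : i = 0 := by omega
    simpa using Or.inl (hC u hu)
  | succ n ih =>
    intro g hg hv
    have hg' : ContDiff ℝ ∞ (deriv g) := (contDiff_infty_iff_deriv.1 hg).2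
    obtain ⟨C, hC0, hC⟩ := ih (deriv g) hg' fun j hj => by
      rw [← iteratedDeriv_succ']
      exact hv (j + 1) (by omega)
    refine ⟨C, hC0, fun i hi u hu => ?_⟩
    cases i with
    | succ i =>
      rw [iteratedDeriv_succ', Nat.add_sub_add_right]
      exact hC i (by omega) u hu
    | zero =>
      have hp : g p = 0 := by simpa using hv 0 (by omega)
      have hsub : Metric.closedBall p |u - p| ⊆ Metric.closedBall p 1 :=
        Metric.closedBall_subset_closedBall (by simpa [Real.dist_eq] using hu)
      have h1 := (convex_closedBall p |u - p|).norm_image_sub_le_of_norm_deriv_le (𝕜 := ℝ) (f := g)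
        (C := C * |u - p| ^ n) (x := p) (y := u)
        (fun x _ => (contDiff_infty_iff_deriv.1 hg).1.differentiableAt)
        (fun x hx => by
          have h2 := hC 0 (Nat.zero_le _) x (hsub hx)
          simp only [iteratedDeriv_zero, Nat.sub_zero] at h2
          refine h2.trans (mul_le_mul_of_nonneg_left ?_ hC0)
          refine pow_le_pow_left₀ (abs_nonneg _) ?_ n
          simpa [Real.dist_eq] using hx)
        (by simp) (by simp [Real.dist_eq])
      rw [hp, sub_zero, Real.norm_eq_abs, Real.norm_eq_abs, mul_assoc, ← pow_succ] at h1
      simpa using h1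

theorem iteratedDeriv_rescale (η : TF) (p ε : ℝ) (m : ℕ) (u : ℝ) :
    iteratedDeriv m (rescale η p ε) u =
      |ε|⁻¹ * (ε⁻¹ ^ m * iteratedDeriv m η ((u - p) / ε)) := by
  have hη : ContDiff ℝ m η := η.contDiff.of_le (by exact_mod_cast le_top)
  have h1 : (⇑(rescale η p ε) : ℝ → ℝ) =
      fun u => |ε|⁻¹ * (fun v => (fun z => η (ε⁻¹ * z)) (v - p)) u := by
    funext u
    simp [div_eq_inv_mul]
  have h2 : iteratedDeriv m (fun v => (fun z => η (ε⁻¹ * z)) (v - p)) u =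
      iteratedDeriv m (fun z => η (ε⁻¹ * z)) (u - p) :=
    congrFun (iteratedDeriv_comp_sub_const m (fun z => η (ε⁻¹ * z)) p) u
  rw [h1, iteratedDeriv_const_mul_field, h2, iteratedDeriv_comp_const_mul hη, div_eq_inv_mul]

theorem exists_jet_bound (η : TF) (N : ℕ) :
    ∃ D, 0 ≤ D ∧ ∀ i ≤ N, ∀ x, |iteratedDeriv i η x| ≤ D :=
  ⟨‖jet N η‖, norm_nonneg _, fun i hi x =>
    ((jet N η ⟨i, by omega⟩).norm_coe_le_norm x).trans
      (norm_le_pi_norm (jet N η) ⟨i, by omega⟩)⟩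

/-- If `g` vanishes at `p` to an order exceeding that of the distribution `f`, then
`⟨f, g(u) η((u - p) / ε)⟩` tends to zero. -/
theorem tendsto_cutoff_of_vanishing {f : 𝓓'((⊤ : TopologicalSpace.Opens ℝ), ℝ)} {a p : ℝ} {N : ℕ}
    {C : ℝ} (hC : 0 ≤ C)
    (hf : ∀ ψ : TF, tsupport ψ ⊆ Icc (-a) a → |f ψ| ≤ C * ‖jet N ψ‖) (ha : |p| + 1 ≤ a)
    {η : TF} (hη : tsupport η ⊆ Icc (-1) 1) (g : ℝ → ℝ) (hg : ContDiff ℝ ∞ g)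
    (hv : ∀ j < N + 1, iteratedDeriv j g p = 0) :
    Tendsto (fun ε => ε * f (smoothMul g hg (rescale η p ε))) (𝓝[>] 0) (𝓝 0) := by
  obtain ⟨A, hA0, hA⟩ := exists_iteratedDeriv_bound_of_vanishing (N + 1) p g hg hv
  obtain ⟨D, hD0, hD⟩ := exists_jet_bound η N
  have hlim : Tendsto (fun ε : ℝ => C * (2 ^ N * (A * D)) * ε) (𝓝[>] 0) (𝓝 0) := by
    have : Tendsto (fun ε : ℝ => C * (2 ^ N * (A * D)) * ε) (𝓝 0)
        (𝓝 (C * (2 ^ N * (A * D)) * 0)) := (continuous_const.mul continuous_id).tendsto 0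
    rw [mul_zero] at this
    exact this.mono_left nhdsWithin_le_nhds
  refine squeeze_zero_norm' ?_ hlim
  filter_upwards [Ioo_mem_nhdsGT (zero_lt_one' ℝ)] with ε hε
  have hε0 : 0 < ε := hε.1
  have hsupp := tsupport_rescale_subset hη p hε0
  rw [← Real.closedBall_eq_Icc, one_mul] at hsupp
  set ψ := smoothMul g hg (rescale η p ε) with hψ
  have hψs : tsupport ψ ⊆ Metric.closedBall p ε := (tsupport_smoothMul_subset _ _ _).trans hsupp
  have hjet : ‖jet N ψ‖ ≤ 2 ^ N * (A * D) := by
    refine norm_jet_le (by positivity) fun i hi u => ?_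
    by_cases hu : u ∈ Metric.closedBall p ε
    · have hu1 : u ∈ Metric.closedBall p 1 := Metric.closedBall_subset_closedBall hε.2.le hu
      have hup : |u - p| ≤ ε := by simpa [Real.dist_eq] using hu
      have hprod : (⇑ψ : ℝ → ℝ) = g * ⇑(rescale η p ε) := rfl
      rw [hprod, iteratedDeriv_mul (hg.of_le (by exact_mod_cast le_top)).contDiffAt
        ((rescale η p ε).contDiff.of_le (by exact_mod_cast le_top)).contDiffAt]
      refine (Finset.abs_sum_le_sum_abs _ _).trans ?_
      have hterm : ∀ j ∈ Finset.range (i + 1),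
          |(i.choose j : ℝ) * iteratedDeriv j g u * iteratedDeriv (i - j) (rescale η p ε) u| ≤
            (i.choose j : ℝ) * (A * D) := by
        intro j hj
        have hj : j ≤ i := Nat.lt_succ_iff.1 (Finset.mem_range.1 hj)
        rw [abs_mul, abs_mul, Nat.abs_cast, mul_assoc]
        refine mul_le_mul_of_nonneg_left ?_ (Nat.cast_nonneg _)
        have h1 : |iteratedDeriv j g u| ≤ A * ε ^ (N + 1 - j) :=
          (hA j (by omega) u hu1).trans
            (mul_le_mul_of_nonneg_left (pow_le_pow_left₀ (abs_nonneg _) hup _) hA0)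
        have h2 : |iteratedDeriv (i - j) (rescale η p ε) u| ≤ ε⁻¹ ^ (i - j + 1) * D := by
          rw [iteratedDeriv_rescale, abs_mul, abs_mul, abs_of_pos hε0,
            abs_of_pos (inv_pos.2 hε0), abs_of_pos (pow_pos (inv_pos.2 hε0) _), ← mul_assoc,
            ← pow_succ']
          exact mul_le_mul_of_nonneg_left (hD _ (by omega) _) (by positivity)
        -- The decay of `g` beats the growth of the cutoff by a factor `ε ^ (N - i)`, while the
        -- outer factor `ε` makes the product tend to zero.
        have h3 : ε ^ (N + 1 - j) * ε⁻¹ ^ (i - j + 1) ≤ 1 := by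
          have h4 : ε ^ (N + 1 - j) ≤ ε ^ (i - j + 1) :=
            pow_le_pow_of_le_one hε0.le hε.2.le (by omega)
          calc ε ^ (N + 1 - j) * ε⁻¹ ^ (i - j + 1) ≤ ε ^ (i - j + 1) * ε⁻¹ ^ (i - j + 1) :=
                mul_le_mul_of_nonneg_right h4 (by positivity)
            _ = 1 := by rw [← mul_pow, mul_inv_cancel₀ hε0.ne', one_pow]
        calc |iteratedDeriv j g u| * |iteratedDeriv (i - j) (rescale η p ε) u|
            ≤ (A * ε ^ (N + 1 - j)) * (ε⁻¹ ^ (i - j + 1) * D) :=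
              mul_le_mul h1 h2 (abs_nonneg _) (by positivity)
          _ = (ε ^ (N + 1 - j) * ε⁻¹ ^ (i - j + 1)) * (A * D) := by ring
          _ ≤ 1 * (A * D) := mul_le_mul_of_nonneg_right h3 (by positivity)
          _ = A * D := one_mul _
      refine (Finset.sum_le_sum hterm).trans ?_
      rw [← Finset.sum_mul, ← Nat.cast_sum, Nat.sum_range_choose, Nat.cast_pow, Nat.cast_ofNat]
      exact mul_le_mul_of_nonneg_right (pow_le_pow_right₀ one_le_two hi) (by positivity)
    · have h0 : iteratedDeriv i ψ u = 0 := by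
        have h1 : u ∉ tsupport ψ := fun h => hu (hψs h)
        have h2 := image_eq_zero_of_notMem_tsupport
          fun h => h1 (tsupport_iteratedFDeriv_subset (𝕜 := ℝ) (f := ψ) i h)
        simp [iteratedDeriv, h2]
      rw [h0, abs_zero]
      positivity
  have hψa : tsupport ψ ⊆ Icc (-a) a := by
    refine hψs.trans ?_
    rw [Real.closedBall_eq_Icc]
    have := neg_abs_le p
    have := le_abs_self p
    exact Icc_subset_Icc (by linarith [hε.2]) (by linarith [hε.2])
  rw [norm_mul, Real.norm_eq_abs, Real.norm_eq_abs, abs_of_pos hε0, mul_comm]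
  exact mul_le_mul_of_nonneg_right
    ((hf ψ hψa).trans (mul_le_mul_of_nonneg_left hjet hC)) hε0.le

/-! ### Removal of isolated points -/

theorem iteratedDeriv_sub_pow (p : ℝ) (k j : ℕ) :
    iteratedDeriv j (fun u : ℝ => (u - p) ^ k) p = if j = k then (k.factorial : ℝ) else 0 := by
  have h : iteratedDeriv j (fun u : ℝ => (fun z : ℝ => z ^ k) (u - p)) p =
      iteratedDeriv j (fun z : ℝ => z ^ k) (p - p) :=
    congrFun (iteratedDeriv_comp_sub_const j (fun z : ℝ => z ^ k) p) p
  rw [show (fun u : ℝ => (u - p) ^ k) = fun u : ℝ => (fun z : ℝ => z ^ k) (u - p) from rfl, h,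
    sub_self, iteratedDeriv_fun_pow_zero, Nat.cast_ite, Nat.cast_zero]

/-- The derivative of a distribution with a point value at `p` puts asymptotically no mass on
shrinking neighborhoods of `p`. The Taylor polynomial of `g` at `p` is removed term by term: each
monomial times the cutoff is a dilated test function, and the remainder falls under the order
bound. -/
theorem tendsto_cutoff_of_hasPointValue {F : 𝓓'((⊤ : TopologicalSpace.Opens ℝ), ℝ)} {p γ : ℝ}
    (hF : HasPointValue F p γ) {η : TF} (hη : tsupport η ⊆ Icc (-1) 1) (g : ℝ → ℝ)
    (hg : ContDiff ℝ ∞ g) :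
    Tendsto (fun ε => ε * (∂_{(1 : ℝ)} F) (smoothMul g hg (rescale η p ε))) (𝓝[>] 0) (𝓝 0) := by
  obtain ⟨N, C, hC, hf⟩ := exists_order_bound (∂_{(1 : ℝ)} F) (|p| + 1)
  suffices h : ∀ m k, m + k = N + 1 → ∀ g : ℝ → ℝ, ∀ hg : ContDiff ℝ ∞ g,
      (∀ j < k, iteratedDeriv j g p = 0) →
      Tendsto (fun ε => ε * (∂_{(1 : ℝ)} F) (smoothMul g hg (rescale η p ε))) (𝓝[>] 0) (𝓝 0) from
    h (N + 1) 0 rfl g hg (by simp)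
  intro m
  induction m with
  | zero =>
    intro k hk g hg hv
    exact tendsto_cutoff_of_vanishing hC hf le_rfl hη g hg fun j hj => hv j (by omega)
  | succ m ih =>
    intro k hk g hg hv
    -- Subtracting the leading Taylor monomial raises the order of vanishing by one.
    set c : ℝ := iteratedDeriv k g p / k.factorial with hc
    have hq : ContDiff ℝ ∞ fun u : ℝ => (u - p) ^ k := by fun_prop
    have hcq : ContDiff ℝ ∞ (c • fun u : ℝ => (u - p) ^ k) := hq.const_smul c
    have hg₁ : ContDiff ℝ ∞ (g - c • fun u : ℝ => (u - p) ^ k) := hg.sub hcq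
    have hy : ContDiff ℝ ∞ fun y : ℝ => y ^ k := by fun_prop
    have h1 := ih (k + 1) (by omega) _ hg₁ fun j hj => by
      rw [iteratedDeriv_sub (hg.of_le (by exact_mod_cast le_top)).contDiffAt
        (hcq.of_le (by exact_mod_cast le_top)).contDiffAt, iteratedDeriv_const_smul_field,
        iteratedDeriv_sub_pow p k j]
      split_ifs with hjk
      · rw [hjk, hc, smul_eq_mul, div_mul_cancel₀ _ (Nat.cast_ne_zero.2 k.factorial_ne_zero),
          sub_self]
      · rw [hv j (by omega)]
        simp
    have h2 := tendsto_deriv_dilate hF (smoothMul _ hy η)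
    have h3 : Tendsto (fun ε : ℝ => c * ε ^ k) (𝓝[>] 0) (𝓝 (c * 0 ^ k)) := by
      have : Continuous fun ε : ℝ => c * ε ^ k := by fun_prop
      exact (this.tendsto 0).mono_left nhdsWithin_le_nhds
    have h4 := h1.add (h3.mul h2)
    rw [mul_zero, add_zero] at h4
    refine h4.congr' ?_
    filter_upwards [self_mem_nhdsWithin] with ε hε
    have hε' : ε ≠ 0 := (mem_Ioi.1 hε).ne'
    -- `(u - p) ^ k η((u - p) / ε)` is `ε ^ k` times the dilate of `y ^ k η(y)`.
    have h5 : smoothMul g hg (rescale η p ε) =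
        smoothMul _ hg₁ (rescale η p ε) + (c * ε ^ k) • rescale (smoothMul _ hy η) p ε := by
      ext u
      change g u * (|ε|⁻¹ * η ((u - p) / ε)) =
        (g u - c * (u - p) ^ k) * (|ε|⁻¹ * η ((u - p) / ε)) +
          (c * ε ^ k) * (|ε|⁻¹ * (((u - p) / ε) ^ k * η ((u - p) / ε)))
      rw [div_pow]
      field_simp
      ring
    rw [h5, map_add, map_smul, smul_eq_mul]
    ring

/-- Isolated singularities of positivity are removable: if `F'` is positive on a punctured ball
around a point where `F` has a point value, it is positive on the ball. -/
theorem posOn_ball_of_posOn_punctured {F : 𝓓'((⊤ : TopologicalSpace.Opens ℝ), ℝ)} {p γ r : ℝ}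
    (hF : HasPointValue F p γ)
    (h : PosOn (addConst (∂_{(1 : ℝ)} F) 0) (Metric.ball p r \ {p})) :
    PosOn (addConst (∂_{(1 : ℝ)} F) 0) (Metric.ball p r) := by
  intro ψ hψ hψs
  rw [addConst_apply, zero_mul, add_zero]
  obtain ⟨η, hη1, hη0, hηle, hηs⟩ := exists_cutoff (isCompact_singleton (x := (0 : ℝ)))
    (Metric.isOpen_ball (x := (0 : ℝ)) (ε := 1)) (by simp)
  have hηI : tsupport η ⊆ Icc (-1) 1 := by
    refine (hηs.trans Metric.ball_subset_closedBall).trans ?_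
    rw [Real.closedBall_eq_Icc]
    simp
  rw [nhdsSet_singleton] at hη1
  refine le_of_tendsto (tendsto_cutoff_of_hasPointValue hF hηI ψ ψ.contDiff) ?_
  filter_upwards [self_mem_nhdsWithin] with ε hε
  have hε0 : 0 < ε := hε
  set χ := smoothMul ψ ψ.contDiff (rescale η p ε) with hχ
  have hval : ∀ u, (ψ - ε • χ) u = ψ u * (1 - η ((u - p) / ε)) := by
    intro u
    change ψ u - ε * (ψ u * (|ε|⁻¹ * η ((u - p) / ε))) = _
    rw [abs_of_pos hε0]
    field_simp
  have h1 := h (ψ - ε • χ) (fun u => by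
      rw [hval]
      exact mul_nonneg (hψ u) (sub_nonneg.2 (hηle _))) (by
      intro u hu
      refine ⟨hψs ?_, ?_⟩
      · have hsub : Function.support ⇑(ψ - ε • χ) ⊆ Function.support ψ := fun v hv h0 =>
          hv (by rw [hval, h0, zero_mul])
        exact closure_mono hsub hu
      · rintro rfl
        refine (notMem_tsupport_iff_eventuallyEq.2 ?_) hu
        have hcont : Tendsto (fun v : ℝ => (v - u) / ε) (𝓝 u) (𝓝 0) := by
          have : Continuous fun v : ℝ => (v - u) / ε := by fun_prop
          simpa using this.tendsto u
        filter_upwards [hcont.eventually hη1] with v hv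
        rw [hval, hv, sub_self, mul_zero, Pi.zero_apply])
  rw [addConst_apply, zero_mul, add_zero, map_sub, map_smul, smul_eq_mul] at h1
  linarith

/-! ### Points of local positivity and cone bounds -/

/-- Positivity is a local property. -/
theorem posOn_of_locally {Λ : TF →ₗ[ℝ] ℝ} {W : Set ℝ}
    (h : ∀ x ∈ W, ∃ r > 0, PosOn Λ (Metric.ball x r)) : PosOn Λ W := by
  intro ψ hψ hψs
  choose! r hr hpos using h
  obtain ⟨s, hs, hcover⟩ := ψ.hasCompactSupport.isCompact.elim_nhds_subcover
    (fun x => Metric.ball x (r x)) fun x hx => Metric.ball_mem_nhds x (hr x (hψs hx))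
  obtain ⟨ρ, hρ⟩ := SmoothPartitionOfUnity.exists_isSubordinate 𝓘(ℝ, ℝ)
    (isClosed_tsupport ψ) (fun i : s => Metric.ball (i : ℝ) (r i))
    (fun _ => Metric.isOpen_ball) (by
      intro x hx
      obtain ⟨i, hi, hxi⟩ := mem_iUnion₂.1 (hcover hx)
      exact mem_iUnion.2 ⟨⟨i, hi⟩, hxi⟩)
  have hsm : ∀ i, ContDiff ℝ ∞ (ρ i) := fun i => (ρ i).contMDiff.contDiff
  have hsum : ψ = ∑ i, smoothMul (ρ i) (hsm i) ψ := by
    ext x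
    have h1 : (∑ i, smoothMul (ρ i) (hsm i) ψ) x = ∑ i, ρ i x * ψ x := by
      rw [FunLike.coe_sum, Finset.sum_apply]
      rfl
    rw [h1, ← Finset.sum_mul]
    by_cases hx : x ∈ tsupport ψ
    · have h2 := ρ.sum_eq_one hx
      rw [finsum_eq_sum_of_fintype] at h2
      rw [h2, one_mul]
    · rw [image_eq_zero_of_notMem_tsupport hx, mul_zero]
  rw [hsum, map_sum]
  refine Finset.sum_nonneg fun i _ => hpos i (hψs (hs i i.2)) _
    (fun x => mul_nonneg (ρ.nonneg i x) (hψ x)) ?_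
  have hsub : Function.support (smoothMul (ρ i) (hsm i) ψ) ⊆ Function.support (ρ i) :=
    fun x hx h0 => hx (by rw [smoothMul_apply, h0, zero_mul])
  exact (closure_mono hsub).trans (hρ i)

/-- The points around which the functional `Λ` is positive. -/
def positivitySet (Λ : TF →ₗ[ℝ] ℝ) : Set ℝ :=
  {x | ∃ r > 0, PosOn Λ (Metric.ball x r)}

theorem isOpen_positivitySet (Λ : TF →ₗ[ℝ] ℝ) : IsOpen (positivitySet Λ) := by
  rw [Metric.isOpen_iff]
  rintro x ⟨r, hr, h⟩
  refine ⟨r, hr, fun y hy => ⟨r - dist y x, sub_pos.2 hy, h.mono ?_⟩⟩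
  exact Metric.ball_subset_ball' (by linarith)

theorem posOn_positivitySet (Λ : TF →ₗ[ℝ] ℝ) : PosOn Λ (positivitySet Λ) :=
  posOn_of_locally fun _ hx => hx

/-- The points `x` such that the `φ`-transform is at least `-(n + 1)` on the cone of slope `T` at
`x`, truncated at height `1 / (n + 1)`. -/
def coneBoundSet (f : 𝓓'((⊤ : TopologicalSpace.Opens ℝ), ℝ)) (φ : TF) (T : ℝ) (n : ℕ) : Set ℝ :=
  {x | ∀ t s : ℝ, 0 < t → t < 1 / (n + 1) → |s| ≤ T →
    -((n : ℝ) + 1) ≤ phiTransform f φ (x + s * t) t}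

theorem isClosed_coneBoundSet (f : 𝓓'((⊤ : TopologicalSpace.Opens ℝ), ℝ)) (φ : TF) (T : ℝ)
    (n : ℕ) : IsClosed (coneBoundSet f φ T n) := by
  simp only [coneBoundSet, ofPred_forall]
  refine isClosed_iInter fun t => isClosed_iInter fun s => isClosed_iInter fun _ =>
    isClosed_iInter fun _ => isClosed_iInter fun _ => ?_
  exact isClosed_le continuous_const ((continuous_phiTransform f φ t).comp (by fun_prop))

theorem exists_mem_coneBoundSet {f : 𝓓'((⊤ : TopologicalSpace.Opens ℝ), ℝ)} {φ : TF} {θ x M : ℝ}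
    (h : ((-M : ℝ) : EReal) ≤ lowerAngular f φ θ x) :
    ∃ n, x ∈ coneBoundSet f φ (Real.tan θ) n := by
  have h1 : ((-(M + 1) : ℝ) : EReal) < lowerAngular f φ θ x :=
    lt_of_lt_of_le (by exact_mod_cast (by linarith : -(M + 1) < -M)) h
  have h2 := eventually_lt_of_lt_liminf h1
  obtain ⟨ε, hε, hsub⟩ := Metric.mem_nhdsWithin_iff.1 h2
  set T := |Real.tan θ| + 1 with hT
  have hT0 : 0 < T := by positivity
  obtain ⟨n, hn⟩ := exists_nat_gt (max (M + 1) (T / ε))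
  refine ⟨n, fun t s ht htn hs => ?_⟩
  have htT : T * t < ε := by
    have h3 : T / ε < n + 1 := ((le_max_right _ _).trans_lt hn).trans (lt_add_one _)
    rw [div_lt_iff₀ hε] at h3
    rw [lt_div_iff₀ (by positivity)] at htn
    by_contra! h4
    nlinarith
  have hst : |s * t| ≤ Real.tan θ * t := by
    rw [abs_mul, abs_of_pos ht]
    exact mul_le_mul_of_nonneg_right hs ht.le
  have hmem : ((x + s * t, t) : ℝ × ℝ) ∈ Metric.ball (x, (0 : ℝ)) ε ∩ cone x θ := by
    refine ⟨?_, ht, by simpa using hst⟩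
    rw [Metric.mem_ball, Prod.dist_eq, max_lt_iff]
    simp only [Real.dist_eq, add_sub_cancel_left, sub_zero, abs_of_pos ht]
    have h5 : Real.tan θ * t ≤ |Real.tan θ| * t :=
      mul_le_mul_of_nonneg_right (le_abs_self _) ht.le
    have h6 := mul_nonneg (abs_nonneg (Real.tan θ)) ht.le
    rw [hT, add_mul, one_mul] at htT
    constructor <;> linarith
  have h7 : ((-(M + 1) : ℝ) : EReal) < (phiTransform f φ (x + s * t) t : EReal) := hsub hmem
  have h8 : -(M + 1) < phiTransform f φ (x + s * t) t := by exact_mod_cast h7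
  have h9 : M + 1 < n := (le_max_left _ _).trans_lt hn
  linarith

/-- If a cone bound holds at all the points of a ball where positivity fails locally, then there
are no such points near the center: the support of `φ((u - x) / t)` either avoids these points, or
meets one of them whose cone contains `(x, t)`, so that the `φ`-transform is bounded below. -/
theorem mem_positivitySet_of_coneBound {f : 𝓓'((⊤ : TopologicalSpace.Opens ℝ), ℝ)} {φ : TF}
    (hφ_pos : ∀ x : ℝ, 0 ≤ φ x) (hφ_int : ∫ x, φ x = 1) {R : ℝ} (hR : tsupport φ ⊆ Icc (-R) R)
    {T : ℝ} (hRT : R < T) {x₀ r : ℝ} (hr : 0 < r)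
    (hup : ∀ᵐ x : ℝ, x ∈ Metric.ball x₀ r → 0 ≤ upperAngular f φ 0 x) {n : ℕ}
    (hb : Metric.ball x₀ r \ positivitySet (addConst f 0) ⊆ coneBoundSet f φ T n) :
    x₀ ∈ positivitySet (addConst f 0) := by
  have ht₀ : 0 < min (1 / ((n : ℝ) + 1)) (r / (2 * (|R| + 1))) := by positivity
  have hlow : ∀ x ∈ Metric.ball x₀ (2 * (r / 4)), ∀ t, 0 < t →
      t < min (1 / ((n : ℝ) + 1)) (r / (2 * (|R| + 1))) →
      -((n : ℝ) + 1) ≤ phiTransform f φ x t := by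
    intro x hx t ht htlt
    have hsupp := tsupport_rescale_subset hR x ht
    have htR : |R| * t < r / 2 := by
      have h1 := htlt.trans_le (min_le_right _ _)
      rw [lt_div_iff₀ (by positivity)] at h1
      linarith
    have hRt : R * t ≤ |R| * t := mul_le_mul_of_nonneg_right (le_abs_self R) ht.le
    by_cases hmeet : ∃ p ∈ Icc (x - R * t) (x + R * t), p ∉ positivitySet (addConst f 0)
    · obtain ⟨p, hpI, hp⟩ := hmeet
      have hpx : |x - p| ≤ R * t := by
        rw [abs_le]
        constructor <;> linarith [hpI.1, hpI.2]
      have hpb : p ∈ Metric.ball x₀ r := by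
        rw [Metric.mem_ball] at hx ⊢
        have h1 := dist_triangle p x x₀
        rw [dist_comm p x, Real.dist_eq x p] at h1
        linarith
      have h2 := hb ⟨hpb, hp⟩ t ((x - p) / t) ht (htlt.trans_le (min_le_left _ _)) (by
        rw [abs_div, abs_of_pos ht, div_le_iff₀ ht]
        exact hpx.trans (mul_le_mul_of_nonneg_right hRT.le ht.le))
      rwa [div_mul_cancel₀ _ ht.ne', add_sub_cancel] at h2
    · push Not at hmeet
      have h1 := posOn_positivitySet (addConst f 0) (rescale φ x t)
        (fun u => mul_nonneg (inv_nonneg.2 (abs_nonneg _)) (hφ_pos _))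
        (fun u hu => hmeet u (hsupp hu))
      rw [addConst_apply, zero_mul, add_zero] at h1
      have h2 : (0 : ℝ) ≤ (n : ℝ) + 1 := by positivity
      exact (neg_nonpos.2 h2).trans h1
  refine ⟨r / 4, by positivity, posOn_of_posOn_addConst (M := (n : ℝ) + 1) hφ_int (by positivity)
    (fun ψ hψ hψs => le_of_le_phiTransform f φ hφ_pos hφ_int ht₀ hlow ψ hψ hψs) ?_⟩
  filter_upwards [hup] with x hx hxr
  exact hx (Metric.ball_subset_ball (by linarith) hxr)

end LojDist


theorem theoremM3
    (f F : 𝓓'((⊤ : TopologicalSpace.Opens ℝ), ℝ))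
    (hF : LojDist.IsLojasiewicz F) (hfF : f = ∂_{(1 : ℝ)} F)
    (U : Set ℝ) (hU : IsOpen U)
    (φ : 𝓓((⊤ : TopologicalSpace.Opens ℝ), ℝ))
    (hφ_pos : ∀ x : ℝ, 0 ≤ φ x) (hφ_int : ∫ x, φ x = 1)
    (R : ℝ) (hR : tsupport φ ⊆ Set.Icc (-R) R)
    (θ : ℝ) (hθ : Real.arctan R < θ) (hθ' : θ < Real.pi / 2)
    (hup : ∀ᵐ x : ℝ, x ∈ U → 0 ≤ LojDist.upperAngular f φ 0 x)
    (E : Set ℝ) (hE : E.Countable)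
    (hlow : ∀ x ∈ U \ E, ∃ M : ℝ, 0 < M ∧ ((-M : ℝ) : EReal) ≤ LojDist.lowerAngular f φ θ x) :
    LojDist.IsMeasureOn f U := by
  set W := LojDist.positivitySet (LojDist.addConst f 0) with hW
  suffices hUW : U ⊆ W by
    obtain ⟨μ, hμ, hfμ⟩ :=
      ((LojDist.posOn_positivitySet (LojDist.addConst f 0)).mono hUW).exists_measure hU
    refine ⟨μ, hμ, fun ψ hψ => ?_⟩
    rw [← hfμ ψ hψ, LojDist.addConst_apply, zero_mul, add_zero]
  have hRT : R < Real.tan θ := by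
    have h := Real.tan_lt_tan_of_lt_of_lt_pi_div_two (Real.neg_pi_div_two_lt_arctan R) hθ' hθ
    rwa [Real.tan_arctan] at h
  by_contra hne
  -- The points of `U` near which `f` is not positive form a Baire space.
  set P : Set ℝ := U ∩ Wᶜ with hP
  have hPlc : IsLocallyClosed P := hU.isLocallyClosed.inter
    (LojDist.isOpen_positivitySet (LojDist.addConst f 0)).isClosed_compl.isLocallyClosed
  have : LocallyCompactSpace P := hPlc.locallyCompactSpace
  have : Nonempty P := by
    obtain ⟨x, hxU, hxW⟩ := not_subset.1 hne
    exact ⟨⟨x, hxU, hxW⟩⟩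
  have : Countable E := hE.to_subtype
  let S : ℕ ⊕ E → Set P := Sum.elim
    (fun n => (↑) ⁻¹' LojDist.coneBoundSet f φ (Real.tan θ) n) (fun e => (↑) ⁻¹' {(e : ℝ)})
  obtain ⟨i, x₀, hx₀⟩ := nonempty_interior_of_iUnion_of_closed (f := S) (by
      rintro (n | e)
      · exact (LojDist.isClosed_coneBoundSet f φ _ n).preimage continuous_subtype_val
      · exact isClosed_singleton.preimage continuous_subtype_val) (by
      refine eq_univ_of_forall fun x => mem_iUnion.2 ?_
      by_cases hx : (x : ℝ) ∈ E
      · exact ⟨Sum.inr ⟨x, hx⟩, rfl⟩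
      · obtain ⟨M, -, hM⟩ := hlow x ⟨x.2.1, hx⟩
        obtain ⟨n, hn⟩ := LojDist.exists_mem_coneBoundSet hM
        exact ⟨Sum.inl n, hn⟩)
  obtain ⟨r₁, hr₁, hball₁⟩ := Metric.mem_nhds_iff.1 (mem_interior_iff_mem_nhds.1 hx₀)
  obtain ⟨r₂, hr₂, hball₂⟩ := Metric.isOpen_iff.1 hU x₀ x₀.2.1
  have hr : 0 < min r₁ r₂ := lt_min hr₁ hr₂
  have hSi : ∀ y (hy : y ∈ Metric.ball (x₀ : ℝ) (min r₁ r₂)) (hyW : y ∉ W),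
      (⟨y, hball₂ (Metric.ball_subset_ball (min_le_right _ _) hy), hyW⟩ : P) ∈ S i :=
    fun y hy hyW => hball₁ (Metric.ball_subset_ball (min_le_left _ _) hy)
  refine x₀.2.2 ?_
  rcases i with n | e
  · refine LojDist.mem_positivitySet_of_coneBound hφ_pos hφ_int hR hRT hr ?_
      fun y hy => hSi y hy.1 hy.2
    filter_upwards [hup] with x hx hxr
    exact hx (hball₂ (Metric.ball_subset_ball (min_le_right _ _) hxr))
  · -- The exceptional point is isolated among the points of non-positivity.
    have hx₀e : (x₀ : ℝ) = e := (interior_subset hx₀ : x₀ ∈ S (Sum.inr e))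
    obtain ⟨γ, hγ⟩ := hF x₀
    have hpunct : Metric.ball (x₀ : ℝ) (min r₁ r₂) \ {(x₀ : ℝ)} ⊆ W := by
      rintro y ⟨hy, hyx⟩
      by_contra hyW
      have h1 : y = e := hSi y hy hyW
      exact hyx (h1.trans hx₀e.symm)
    have h2 := (LojDist.posOn_positivitySet (LojDist.addConst f 0)).mono hpunct
    rw [hfF] at h2
    refine ⟨min r₁ r₂, hr, ?_⟩
    rw [hfF]
    exact LojDist.posOn_ball_of_posOn_punctured hγ h2
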